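/- Let $\Omega\subset\mathbb{R}^N$ be a bounded domain, let $\mathcal{O}\subset\mathbb{R}^N$ be open with $\overline\Omega\subset\mathcal{O}$, let $\mathcal{S}_N$ be the space of real symmetric $N\times N$ matrices with its usual partial order, and let $F:\mathcal{O}\times\mathbb{R}\times\mathbb{R}^N\times\mathcal{S}_N\to\mathbb{R}$ be continuous. We write $F[u](x)=F(x,u(x),Du(x),D^2u(x))$. Assume: (H1) $F(x,r,p,X+Y)-F(x,r,p,X)\le 0$ for all $x\in\mathcal{O}$, $r\in\mathbb{R}$, $p\in\mathbb{R}^N$, $X,Y\in\mathcal{S}_N$ with $Y\ge 0$. (H2) There is $\alpha>0$ such that $F(x,\tau r,\tau p,\tau X)=\tau^\alpha F(x,r,p,X)$ for all $(x,r,p,X)\in\mathcal{O}\times\mathbb{R}\times\mathbb{R}^N\times\mathcal{S}_N$ and $\tau\ge 0$. (H3) $r\mapsto F(x,r,p,X)$ is continuous, uniformly with respect to $(x,p,X)\in\mathcal{O}\times\mathbb{R}^N\times\mathcal{S}_N$. (H4) For every $R>0$ there is $\omega\in C([0,+\infty))$ with $\omega(0)=0$ such that, whenever $X,Y\in\mathcal{S}_N$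 and $\sigma>0$ satisfy $$-3\sigma\begin{pmatrix} I&0\\0&I\end{pmatrix}\le\begin{pmatrix} X&0\\0&-Y\end{pmatrix}\le 3\sigma\begin{pmatrix} I&-I\\-I&I\end{pmatrix},$$ one has $F(y,r,\sigma(x-y),Y)-F(x,r,\sigma(x-y),X)\le\omega(\sigma|x-y|^2+|x-y|)$ for all $x,y\in\mathcal{O}$ and $|r|\le R$. Define $$\mu_1(F,\Omega):=\sup\{\lambda\in\mathbb{R}:\ \exists\,\Omega'\text{ open},\ \overline\Omega\subset\Omega'\subset\mathcal{O},\ \exists\,\phi\in LSC(\Omega'),\ \phi>0\text{ and }F[\phi]-\lambda\phi^\alpha\ge0\text{ in }\Omega'\}\in[-\infty,+\infty],$$ where the differential inequality is meant in the viscosity sense: $F(\xi,\phi(\xi),D\psi(\xi),D^2\psi(\xi))-\lambda\phi(\xi)^\alpha\ge0$ whenever $\psi\in C^2(\mathbb{R}^N)$ and $\phi-\psi$ has a local minimum at $\xi\in\Omega'$. For $G:\mathcal{O}\times\mathbb{R}\times\mathbb{R}^N\times\mathcal{S}_N\to[-\infty,+\infty]$, a function $u\in USC(\overline\Omega)$ is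 called a subsolution of $G[u]\le0$ in $\Omega$, $u\le0$ on $\partial\Omega$ (in the relaxed viscosity sense) if, for all $\varphi\in C^2(\mathbb{R}^N)$ and $\xi\in\overline\Omega$ such that $(u-\varphi)(\xi)=\max_{\overline\Omega}(u-\varphi)$, $$G(\xi,u(\xi),D\varphi(\xi),D^2\varphi(\xi))\le0\ \text{ if }\xi\in\Omega,\qquad \min\big[u(\xi),\,G(\xi,u(\xi),D\varphi(\xi),D^2\varphi(\xi))\big]\le0\ \text{ if }\xi\in\partial\Omega.$$ $F$ satisfies the Maximum Principle in $\Omega$ if every such subsolution $u\in USC(\overline\Omega)$ with $G=F$ satisfies $u\le0$ in $\overline\Omega$. Then there exists a nonnegative function $U\in USC(\overline\Omega)$, $U\not\equiv0$, which is a subsolution, in the relaxed viscosity sense above, of $$F[U]-\mu_1(F,\Omega)U^\alpha\le0\ \text{ in }\Omega,\qquad U\le0\ \text{ on }\partial\Omega$$ (with the convention $(+\infty)\cdot0=0$ if $\mu_1(F,\Omega)=+\infty$). Moreover, if $F$ satisfies the Maximum Principle in $\Omega$, then $\mu_1(F,\Omega)>0$. -/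

import Mathlib

noncomputable section

namespace DegEll

/-- The Euclidean space `ℝ^N`. -/
abbrev Sp (N : ℕ) : Type := EuclideanSpace ℝ (Fin N)

/-- Real `N × N` matrices; operators below are only ever evaluated at (and only ever constrained on)
symmetric ones. -/
abbrev Mat (N : ℕ) : Type := Matrix (Fin N) (Fin N) ℝ

/-- Second order operators `F(x, r, p, X)`. Only the values for `x` in the relevant set and `X`
symmetric matter. -/
abbrev Op (N : ℕ) : Type := Sp N → ℝ → Sp N → Mat N → ℝ

/-- The Hessian matrix `D²φ(x)`. -/
def hessian {N : ℕ} (φ : Sp N → ℝ) (x : Sp N) : Mat N :=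
  Matrix.of fun i j =>
    fderiv ℝ (fderiv ℝ φ) x (EuclideanSpace.single i 1) (EuclideanSpace.single j 1)

/-- `F` is continuous on `𝒪 × ℝ × ℝ^N × 𝒮_N`. -/
def ContinuousOp {N : ℕ} (F : Op N) (O : Set (Sp N)) : Prop :=
  ContinuousOn (fun q : Sp N × ℝ × Sp N × Mat N => F q.1 q.2.1 q.2.2.1 q.2.2.2)
    {q | q.1 ∈ O ∧ q.2.2.2.IsSymm}

/-- (H1) Degenerate ellipticity. -/
def H1 {N : ℕ} (F : Op N) (O : Set (Sp N)) : Prop :=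
  ∀ x ∈ O, ∀ (r : ℝ) (p : Sp N) (X Y : Mat N), X.IsSymm → Y.PosSemidef →
    F x r p (X + Y) - F x r p X ≤ 0

/-- (H2) Positive homogeneity of degree `α`. -/
def H2 {N : ℕ} (F : Op N) (O : Set (Sp N)) (α : ℝ) : Prop :=
  ∀ x ∈ O, ∀ (r : ℝ) (p : Sp N) (X : Mat N), X.IsSymm → ∀ τ : ℝ, 0 ≤ τ →
    F x (τ * r) (τ • p) (τ • X) = τ ^ α * F x r p X

/-- (H3) `r ↦ F(x,r,p,X)` is continuous, uniformly with respect to `(x,p,X)`. -/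
def H3 {N : ℕ} (F : Op N) (O : Set (Sp N)) : Prop :=
  ∀ r : ℝ, ∀ ε > 0, ∃ δ > 0, ∀ s : ℝ, |s - r| < δ →
    ∀ x ∈ O, ∀ (p : Sp N) (X : Mat N), X.IsSymm → |F x s p X - F x r p X| < ε

/-- The two-sided matrix inequality
`-3σ [I 0; 0 I] ≤ [X 0; 0 -Y] ≤ 3σ [I -I; -I I]`. -/
def BlockIneq {N : ℕ} (σ : ℝ) (X Y : Mat N) : Prop :=
  (Matrix.fromBlocks X 0 0 (-Y) - (-(3 * σ)) • Matrix.fromBlocks (1 : Mat N) 0 0 1).PosSemidef ∧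
  ((3 * σ) • Matrix.fromBlocks (1 : Mat N) (-1) (-1) 1 - Matrix.fromBlocks X 0 0 (-Y)).PosSemidef

/-- (H4) The structure condition. -/
def H4 {N : ℕ} (F : Op N) (O : Set (Sp N)) : Prop :=
  ∀ R > 0, ∃ ω : ℝ → ℝ, ContinuousOn ω (Set.Ici 0) ∧ ω 0 = 0 ∧
    ∀ X Y : Mat N, X.IsSymm → Y.IsSymm → ∀ σ > 0, BlockIneq σ X Y →
      ∀ x ∈ O, ∀ y ∈ O, ∀ r : ℝ, |r| ≤ R →
        F y r (σ • (x - y)) Y - F x r (σ • (x - y)) X ≤ ω (σ * ‖x - y‖ ^ 2 + ‖x - y‖)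

/-- `φ` is a viscosity supersolution of `F[φ] - l φ^α ≥ 0` in the open set `V`
(used for positive `φ`). -/
def IsSupersolution {N : ℕ} (F : Op N) (α l : ℝ) (V : Set (Sp N)) (φ : Sp N → ℝ) : Prop :=
  ∀ ψ : Sp N → ℝ, ContDiff ℝ 2 ψ → ∀ ξ ∈ V, IsLocalMinOn (fun x => φ x - ψ x) V ξ →
    0 ≤ F ξ (φ ξ) (gradient ψ ξ) (hessian ψ ξ) - l * φ ξ ^ α

/-- The generalized principal eigenvalue `μ₁(F, Ω)`, an element of `[-∞, +∞]`, for an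
`α`-homogeneous operator given in the open set `O`. -/
def mu1 {N : ℕ} (F : Op N) (α : ℝ) (O Ω : Set (Sp N)) : EReal :=
  sSup ((fun l : ℝ => (l : EReal)) '' {l : ℝ | ∃ V : Set (Sp N), IsOpen V ∧ closure Ω ⊆ V ∧ V ⊆ O ∧
    ∃ φ : Sp N → ℝ, LowerSemicontinuousOn φ V ∧ (∀ x ∈ V, 0 < φ x) ∧ IsSupersolution F α l V φ})

/-- `u` is a viscosity subsolution of `G(x,u,Du,D²u) ≤ 0` in `Ω`, `u ≤ 0` on `∂Ω`, the
boundary condition being understood in the relaxed viscosity sense: at a boundary point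
touched from above by a test function, `u ≤ 0` or the differential inequality holds.
`G` may take extended real values. -/
def IsDirichletSubsolution {N : ℕ} (G : Sp N → ℝ → Sp N → Mat N → EReal) (Ω : Set (Sp N))
    (u : Sp N → ℝ) : Prop :=
  ∀ φ : Sp N → ℝ, ContDiff ℝ 2 φ → ∀ ξ ∈ closure Ω, IsMaxOn (fun x => u x - φ x) (closure Ω) ξ →
    (ξ ∈ Ω → G ξ (u ξ) (gradient φ ξ) (hessian φ ξ) ≤ 0) ∧
    (ξ ∈ frontier Ω → min (u ξ : EReal) (G ξ (u ξ) (gradient φ ξ) (hessian φ ξ)) ≤ 0)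

/-- The Maximum Principle in `Ω`: every upper semicontinuous viscosity subsolution of the
Dirichlet problem `F[u] = 0` in `Ω`, `u = 0` on `∂Ω` is nonpositive in `closure Ω`. -/
def MaximumPrinciple {N : ℕ} (F : Op N) (Ω : Set (Sp N)) : Prop :=
  ∀ u : Sp N → ℝ, UpperSemicontinuousOn u (closure Ω) →
    IsDirichletSubsolution (fun x r p X => (F x r p X : EReal)) Ω u →
    ∀ x ∈ closure Ω, u x ≤ 0

/-- The operator `F[u] - m u^α` for an extended real number `m`; for `m = +∞` the convention
`(+∞) * 0 = 0` of `EReal` is in force. It is only used for `u ≥ 0`. -/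
def eigenOp {N : ℕ} (F : Op N) (α : ℝ) (m : EReal) (x : Sp N) (r : ℝ) (p : Sp N) (X : Mat N) :
    EReal :=
  (F x r p X : EReal) - m * ((r ^ α : ℝ) : EReal)

end DegEll

end

/-!
Above the eigenvalue the nonnegative subsolutions of `F[u] ≤ λ u^α + 1` on a compact neighbourhood
of `closure Ω` cannot be bounded: otherwise Perron's method applies to the largest of them, and its
lower semicontinuous envelope is a positive supersolution, contradicting the definition of
`mu1`. Dividing unbounded subsolutions by their maxima gives, by homogeneity, subsolutions of
`F[u] ≤ λ u^α + ε` with maximum `1`; the upper half-relaxed limit as `λ ↓ mu1`, `ε ↓ 0` and the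
neighbourhoods shrink to `closure Ω` is `U`. If `mu1 ≤ 0` then `U` is also a subsolution for `F`
itself, which violates the Maximum Principle.
-/

noncomputable section

open Filter Topology Set

namespace DegEll

section SecondDerivative

theorem deriv_deriv_nonneg_of_isLocalMin {g : ℝ → ℝ} {t : ℝ} (hg : ContinuousAt g t)
    (hmin : IsLocalMin g t) : 0 ≤ deriv (deriv g) t := by
  by_contra! hneg
  have hmax : IsLocalMax g t := isLocalMax_of_deriv_deriv_neg hneg hmin.deriv_eq_zero hg
  have hconst : g =ᶠ[𝓝 t] fun _ => g t := by
    filter_upwards [hmin, hmax] with s h₁ h₂ using le_antisymm h₂ h₁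
  have hzero : deriv (deriv g) t = 0 := by simp [hconst.deriv.deriv_eq]
  exact hneg.ne hzero

variable {E : Type*} [NormedAddCommGroup E] [NormedSpace ℝ E] {f : E → ℝ} {ξ : E}

theorem differentiable_fderiv (hf : ContDiff ℝ 2 f) : Differentiable ℝ (fderiv ℝ f) :=
  (hf.fderiv_right (m := 1) (by norm_num)).differentiable (by norm_num)

theorem deriv_deriv_comp_line (hf : ContDiff ℝ 2 f) (ξ v : E) :
    deriv (deriv fun t : ℝ => f (ξ + t • v)) 0 = fderiv ℝ (fderiv ℝ f) ξ v v := by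
  have hline (t : ℝ) : HasDerivAt (fun t : ℝ => ξ + t • v) v t := by
    simpa using ((hasDerivAt_id t).smul_const v).const_add ξ
  have hfirst : (deriv fun t : ℝ => f (ξ + t • v)) = fun t => fderiv ℝ f (ξ + t • v) v :=
    funext fun t =>
      ((hf.differentiable (by norm_num) _).hasFDerivAt.comp_hasDerivAt t (hline t)).deriv
  have hsecond := (differentiable_fderiv hf _).hasFDerivAt.comp_hasDerivAt 0 (hline 0)
  simpa [hfirst] using! (hsecond.clm_apply (hasDerivAt_const (0 : ℝ) v)).deriv

theorem fderiv_fderiv_nonneg_of_isLocalMin (hf : ContDiff ℝ 2 f) (hmin : IsLocalMin f ξ) (v : E) :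
    0 ≤ fderiv ℝ (fderiv ℝ f) ξ v v := by
  have hline : Continuous fun t : ℝ => ξ + t • v := by fun_prop
  rw [← deriv_deriv_comp_line hf]
  refine deriv_deriv_nonneg_of_isLocalMin (hf.continuous.comp hline).continuousAt ?_
  exact IsLocalMin.comp_continuous (g := fun t : ℝ => ξ + t • v) (by simpa using hmin)
    hline.continuousAt

theorem fderiv_fderiv_sq_eq_zero (hf : ContDiff ℝ 2 f) (h₀ : f ξ = 0) (h₁ : fderiv ℝ f ξ = 0) :
    fderiv ℝ (fderiv ℝ fun x => f x ^ 2) ξ = 0 := by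
  have hd : Differentiable ℝ f := hf.differentiable (by norm_num)
  have hfirst : (fderiv ℝ fun x => f x ^ 2) = fun x => (2 * f x) • fderiv ℝ f x :=
    funext fun x => by simpa using ((hd x).hasFDerivAt.pow 2).fderiv
  have hsecond :=
    ((hd ξ).hasFDerivAt.const_mul 2).smul (differentiable_fderiv hf ξ).hasFDerivAt
  rw [hfirst]
  refine hsecond.fderiv.trans ?_
  ext
  simp [h₀, h₁]

end SecondDerivative

section TestFunctions

variable {N : ℕ} {φ ψ : Sp N → ℝ} {ξ : Sp N}

theorem continuous_gradient (hφ : ContDiff ℝ 2 φ) : Continuous (gradient φ) :=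
  (InnerProductSpace.toDual ℝ (Sp N)).symm.continuous.comp (hφ.continuous_fderiv (by norm_num))

theorem gradient_add (hφ : ContDiff ℝ 2 φ) (hψ : ContDiff ℝ 2 ψ) (x : Sp N) :
    gradient (φ + ψ) x = gradient φ x + gradient ψ x := by
  have h := fderiv_add (hφ.differentiable (by norm_num) x) (hψ.differentiable (by norm_num) x)
  simp only [gradient, h, map_add]

theorem gradient_const_smul (c : ℝ) (φ : Sp N → ℝ) (x : Sp N) :
    gradient (c • φ) x = c • gradient φ x := by
  simp [gradient, fderiv_const_smul_field]

theorem gradient_add_const (φ : Sp N → ℝ) (c : ℝ) (x : Sp N) :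
    gradient (fun y => φ y + c) x = gradient φ x := by
  simp [gradient]

theorem gradient_eq_zero_of_isLocalMin (hmin : IsLocalMin φ ξ) : gradient φ ξ = 0 := by
  simp [gradient, hmin.fderiv_eq_zero]

theorem continuous_hessian (hφ : ContDiff ℝ 2 φ) : Continuous (hessian φ) := by
  have h : Continuous (fderiv ℝ (fderiv ℝ φ)) :=
    (hφ.fderiv_right (m := 1) (by norm_num)).continuous_fderiv (by norm_num)
  exact continuous_matrix fun i j => (h.clm_apply continuous_const).clm_apply continuous_const

theorem isSymm_hessian (hφ : ContDiff ℝ 2 φ) (x : Sp N) : (hessian φ x).IsSymm := by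
  ext i j
  exact hφ.contDiffAt.isSymmSndFDerivAt (by simp) _ _

theorem hessian_add (hφ : ContDiff ℝ 2 φ) (hψ : ContDiff ℝ 2 ψ) (x : Sp N) :
    hessian (φ + ψ) x = hessian φ x + hessian ψ x := by
  have hfirst : fderiv ℝ (φ + ψ) = fderiv ℝ φ + fderiv ℝ ψ := funext fun y =>
    fderiv_add (hφ.differentiable (by norm_num) y) (hψ.differentiable (by norm_num) y)
  have hsecond := fderiv_add (differentiable_fderiv hφ x) (differentiable_fderiv hψ x)
  ext i j
  simp [hessian, hfirst, hsecond]

theorem hessian_const_smul (c : ℝ) (φ : Sp N → ℝ) (x : Sp N) :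
    hessian (c • φ) x = c • hessian φ x := by
  have hfirst : fderiv ℝ (c • φ) = c • fderiv ℝ φ := fderiv_const_smul_field c
  have hsecond : fderiv ℝ (c • fderiv ℝ φ) = c • fderiv ℝ (fderiv ℝ φ) :=
    fderiv_const_smul_field (f := fderiv ℝ φ) c
  ext i j
  simp [hessian, hfirst, hsecond]

theorem hessian_add_const (φ : Sp N → ℝ) (c : ℝ) (x : Sp N) :
    hessian (fun y => φ y + c) x = hessian φ x := by
  simp [hessian, funext fun y => fderiv_add_const (𝕜 := ℝ) (f := φ) (x := y) c]

theorem hessian_const (c : ℝ) (x : Sp N) : hessian (fun _ => c) x = 0 := by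
  ext i j
  simp [hessian]

theorem dotProduct_hessian_mulVec (φ : Sp N → ℝ) (ξ : Sp N) (x : Fin N → ℝ) :
    x ⬝ᵥ (hessian φ ξ).mulVec x =
      fderiv ℝ (fderiv ℝ φ) ξ (WithLp.toLp 2 x) (WithLp.toLp 2 x) := by
  have hx : WithLp.toLp 2 x = ∑ i, x i • EuclideanSpace.single i (1 : ℝ) := by
    ext j
    simp [Finset.sum_apply, Pi.single_apply]
  rw [hx]
  simp only [dotProduct, Matrix.mulVec, hessian, Matrix.of_apply, map_sum, map_smul,
    _root_.sum_apply, _root_.smul_apply, smul_eq_mul, Finset.mul_sum]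
  rw [Finset.sum_comm]
  refine Finset.sum_congr rfl fun i _ => Finset.sum_congr rfl fun j _ => ?_
  ring

theorem posSemidef_hessian_of_isLocalMin (hφ : ContDiff ℝ 2 φ) (hmin : IsLocalMin φ ξ) :
    (hessian φ ξ).PosSemidef := by
  refine Matrix.PosSemidef.of_dotProduct_mulVec_nonneg ?_ fun x => ?_
  · rw [Matrix.IsHermitian, Matrix.conjTranspose_eq_transpose_of_trivial]
    exact isSymm_hessian hφ ξ
  · rw [star_trivial, dotProduct_hessian_mulVec]
    exact fderiv_fderiv_nonneg_of_isLocalMin hφ hmin _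

/-- The penalization `‖x - ξ‖⁴`, which makes extrema at `ξ` strict without changing the first two
derivatives there. -/
def quartic (ξ x : Sp N) : ℝ := (‖x - ξ‖ ^ 2) ^ 2

theorem contDiff_normSq_sub (ξ : Sp N) : ContDiff ℝ 2 fun x : Sp N => ‖x - ξ‖ ^ 2 :=
  (contDiff_id.sub contDiff_const).norm_sq ℝ

theorem contDiff_quartic (ξ : Sp N) : ContDiff ℝ 2 (quartic ξ) :=
  (contDiff_normSq_sub ξ).pow 2

theorem quartic_self (ξ : Sp N) : quartic ξ ξ = 0 := by simp [quartic]

theorem quartic_pos {x : Sp N} (h : x ≠ ξ) : 0 < quartic ξ x := by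
  have : 0 < ‖x - ξ‖ := norm_pos_iff.2 (sub_ne_zero.2 h)
  unfold quartic
  positivity

theorem gradient_quartic_self (ξ : Sp N) : gradient (quartic ξ) ξ = 0 :=
  gradient_eq_zero_of_isLocalMin <| Eventually.of_forall fun x => by
    rw [quartic_self, quartic]
    positivity

theorem hessian_quartic_self (ξ : Sp N) : hessian (quartic ξ) ξ = 0 := by
  have hfirst : fderiv ℝ (fun x : Sp N => ‖x - ξ‖ ^ 2) ξ = 0 :=
    IsLocalMin.fderiv_eq_zero <| Eventually.of_forall fun x => by simp
  have hsecond : fderiv ℝ (fderiv ℝ (quartic ξ)) ξ = 0 :=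
    fderiv_fderiv_sq_eq_zero (contDiff_normSq_sub ξ) (by simp) hfirst
  ext i j
  simp [hessian, hsecond]

theorem gradient_add_smul_quartic_self (hφ : ContDiff ℝ 2 φ) (c : ℝ) (ξ : Sp N) :
    gradient (φ + c • quartic ξ) ξ = gradient φ ξ := by
  have hq : ContDiff ℝ 2 (c • quartic ξ) := (contDiff_quartic ξ).const_smul c
  rw [gradient_add hφ hq, gradient_const_smul,
    gradient_quartic_self, smul_zero, add_zero]

theorem hessian_add_smul_quartic_self (hφ : ContDiff ℝ 2 φ) (c : ℝ) (ξ : Sp N) :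
    hessian (φ + c • quartic ξ) ξ = hessian φ ξ := by
  have hq : ContDiff ℝ 2 (c • quartic ξ) := (contDiff_quartic ξ).const_smul c
  rw [hessian_add hφ hq, hessian_const_smul,
    hessian_quartic_self, smul_zero, add_zero]

end TestFunctions

section Operator

variable {N : ℕ} {F : Op N} {O : Set (Sp N)} {α : ℝ} {φ ψ : Sp N → ℝ} {ξ : Sp N}

theorem H1.le_of_isLocalMin (h1 : H1 F O) (hφ : ContDiff ℝ 2 φ) (hψ : ContDiff ℝ 2 ψ)
    (hξ : ξ ∈ O) (hmin : IsLocalMin (φ - ψ) ξ) (r : ℝ) :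
    F ξ r (gradient φ ξ) (hessian φ ξ) ≤ F ξ r (gradient ψ ξ) (hessian ψ ξ) := by
  have hsub : ContDiff ℝ 2 (φ - ψ) := hφ.sub hψ
  have hgrad : gradient φ ξ = gradient ψ ξ := by
    simpa [gradient_eq_zero_of_isLocalMin hmin] using gradient_add hψ hsub ξ
  have hhess : hessian φ ξ = hessian ψ ξ + hessian (φ - ψ) ξ := by
    simpa using hessian_add hψ hsub ξ
  rw [hgrad, hhess]
  exact sub_nonpos.1 <| h1 ξ hξ r _ _ _ (isSymm_hessian hψ ξ)
    (posSemidef_hessian_of_isLocalMin hsub hmin)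

theorem H2.apply_zero (h2 : H2 F O α) (hα : 0 < α) (hξ : ξ ∈ O) : F ξ 0 0 0 = 0 := by
  simpa [Real.zero_rpow hα.ne'] using h2 ξ hξ 0 0 0 Matrix.isSymm_zero 0 le_rfl

theorem ContinuousOp.continuousAt_comp_test (hF : ContinuousOp F O) (hO : IsOpen O)
    (hφ : ContDiff ℝ 2 φ) (hξ : ξ ∈ O) (r : ℝ) :
    ContinuousAt (fun q : Sp N × ℝ => F q.1 q.2 (gradient φ q.1) (hessian φ q.1)) (ξ, r) := by
  have hjet : Continuous fun q : Sp N × ℝ => (q.1, q.2, gradient φ q.1, hessian φ q.1) :=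
    continuous_fst.prodMk <| continuous_snd.prodMk <|
      ((continuous_gradient hφ).comp continuous_fst).prodMk
        ((continuous_hessian hφ).comp continuous_fst)
  have hon : ContinuousOn (fun q : Sp N × ℝ => F q.1 q.2 (gradient φ q.1) (hessian φ q.1))
      (Prod.fst ⁻¹' O) :=
    hF.comp hjet.continuousOn fun q hq => ⟨hq, isSymm_hessian hφ q.1⟩
  exact hon.continuousAt ((hO.preimage continuous_fst).mem_nhds hξ)

theorem ContinuousOp.tendsto_residual {β : Type*} {l : Filter β} {x : β → Sp N} {r lam c : β → ℝ}
    {r₀ lam₀ c₀ : ℝ} (hF : ContinuousOp F O) (hO : IsOpen O) (hα : 0 < α) (hφ : ContDiff ℝ 2 φ)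
    (hξ : ξ ∈ O) (hx : Tendsto x l (𝓝 ξ)) (hr : Tendsto r l (𝓝 r₀))
    (hlam : Tendsto lam l (𝓝 lam₀)) (hc : Tendsto c l (𝓝 c₀)) :
    Tendsto (fun b => F (x b) (r b) (gradient φ (x b)) (hessian φ (x b)) -
        (lam b * r b ^ α + c b)) l
      (𝓝 (F ξ r₀ (gradient φ ξ) (hessian φ ξ) - (lam₀ * r₀ ^ α + c₀))) :=
  ((hF.continuousAt_comp_test hO hφ hξ r₀).tendsto.comp (hx.prodMk_nhds hr)).sub
    ((hlam.mul (hr.rpow_const (Or.inr hα.le))).add hc)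

end Operator

section UpperLimit

variable {ι E : Type*} [TopologicalSpace E] {l : Filter ι} {f : ι → E → ℝ} {v φ : E → ℝ} {ξ : E}

/-- `v` is the upper half-relaxed limit `v x = limsup f i y`, as `i → l` and `y → x`, of the
family `f`. It is a predicate because the `limsup` of a locally unbounded family would be a junk
value. -/
structure IsUpperLim (l : Filter ι) (f : ι → E → ℝ) (v : E → ℝ) : Prop where
  eventually_lt : ∀ ⦃x a⦄, v x < a → ∀ᶠ p in l ×ˢ 𝓝 x, f p.1 p.2 < a
  frequently_lt : ∀ ⦃x a⦄, a < v x → ∃ᶠ p in l ×ˢ 𝓝 x, a < f p.1 p.2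

theorem isUpperLim_limsup [NeBot l] {m M : ℝ} (hf : ∀ i x, f i x ∈ Icc m M) :
    IsUpperLim l f fun x => limsup (fun p : ι × E => f p.1 p.2) (l ×ˢ 𝓝 x) := by
  have hbdd (x : E) : IsBoundedUnder (· ≤ ·) (l ×ˢ 𝓝 x) fun p : ι × E => f p.1 p.2 :=
    isBoundedUnder_of ⟨M, fun p => (hf p.1 p.2).2⟩
  have hcobdd (x : E) : IsCoboundedUnder (· ≤ ·) (l ×ˢ 𝓝 x) fun p : ι × E => f p.1 p.2 :=
    (isBoundedUnder_of ⟨m, fun p : ι × E => (hf p.1 p.2).1⟩ :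
      IsBoundedUnder (· ≥ ·) _ _).isCoboundedUnder_le
  exact ⟨fun x _ h => eventually_lt_of_limsup_lt h (hbdd x),
    fun x _ h => frequently_lt_of_lt_limsup (hcobdd x) h⟩

theorem eventually_forall_mem_of_isCompact {K : Set E} (hK : IsCompact K) {P : ι × E → Prop}
    (hP : ∀ x ∈ K, ∀ᶠ p in l ×ˢ 𝓝 x, P p) : ∀ᶠ i in l, ∀ x ∈ K, P (i, x) := by
  have h : ∀ᶠ p in l ×ˢ 𝓝ˢ K, P p := hK.mem_prod_nhdsSet_of_forall hP
  exact h.curry.mono fun i hi => hi.self_of_nhdsSet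

namespace IsUpperLim

theorem upperSemicontinuous (hv : IsUpperLim l f v) : UpperSemicontinuous v := by
  intro x a hxa
  obtain ⟨b, hxb, hba⟩ := exists_between hxa
  obtain ⟨P, hP, Q, hQ, hPQ⟩ := eventually_prod_iff.1 (hv.eventually_lt hxb)
  filter_upwards [hQ.eventually_nhds] with y hy
  by_contra! hay
  obtain ⟨p, hbp, hPp, hQp⟩ :=
    ((hv.frequently_lt (hba.trans_le hay)).and_eventually (hP.prod_mk hy)).exists
  exact hbp.not_gt (hPQ hPp hQp)

theorem le_of_forall_ge [NeBot l] (hv : IsUpperLim l f v) {m : ℝ} (hf : ∀ i x, m ≤ f i x) (x : E) :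
    m ≤ v x := by
  by_contra! hlt
  obtain ⟨p, hp⟩ := (hv.eventually_lt hlt).exists
  exact (hf p.1 p.2).not_gt hp

theorem le_of_eventually_le (hv : IsUpperLim l f v) {x : E} {a : ℝ}
    (hf : ∀ᶠ p in l ×ˢ 𝓝 x, f p.1 p.2 ≤ a) : v x ≤ a := by
  by_contra! hlt
  obtain ⟨p, hlt, hle⟩ := ((hv.frequently_lt hlt).and_eventually hf).exists
  exact hlt.not_ge hle

theorem apply_le_of_top (hv : IsUpperLim ⊤ f v) (i : ι) (x : E) : f i x ≤ v x := by
  by_contra! hlt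
  exact lt_irrefl _ (eventually_top.1 (hv.eventually_lt hlt).curry i).self_of_nhds

theorem exists_le_of_isCompact (hv : IsUpperLim l f v) {K : Set E} (hK : IsCompact K) {a : ℝ}
    (hf : ∃ᶠ i in l, ∃ x ∈ K, a ≤ f i x) : ∃ x ∈ K, a ≤ v x := by
  by_contra! hlt
  have hlt_a : ∀ᶠ i in l, ∀ x ∈ K, f i x < a :=
    eventually_forall_mem_of_isCompact hK fun x hx => hv.eventually_lt (hlt x hx)
  refine hf (hlt_a.mono ?_)
  rintro i hi ⟨x, hx, hax⟩
  exact hax.not_gt (hi x hx)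

theorem sub_continuous (hv : IsUpperLim l f v) (hφ : Continuous φ) :
    IsUpperLim l (fun i => f i - φ) (v - φ) where
  eventually_lt x a h := by
    obtain ⟨b, hvb, hba⟩ := exists_between (sub_lt_iff_lt_add.1 h)
    have hφb : ∀ᶠ y in 𝓝 x, b < a + φ y := (hφ.const_add a).continuousAt.eventually_const_lt hba
    filter_upwards [hv.eventually_lt hvb, tendsto_snd.eventually hφb] with p hp hφp
    exact sub_lt_iff_lt_add.2 (hp.trans hφp)
  frequently_lt x a h := by
    obtain ⟨b, hab, hbv⟩ := exists_between (lt_sub_iff_add_lt.1 h)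
    have hφb : ∀ᶠ y in 𝓝 x, a + φ y < b := (hφ.const_add a).continuousAt.eventually_lt_const hab
    refine ((hv.frequently_lt hbv).and_eventually (tendsto_snd.eventually hφb)).mono ?_
    exact fun p hp => lt_sub_iff_add_lt.2 (hp.2.trans hp.1)

end IsUpperLim

theorem exists_lt_forall_le_of_isCompact (hv : UpperSemicontinuous v) {K : Set E}
    (hK : IsCompact K) {b : ℝ} (hlt : ∀ x ∈ K, v x < b) : ∃ a < b, ∀ x ∈ K, v x ≤ a := by
  obtain rfl | hne := K.eq_empty_or_nonempty
  · exact (exists_lt b).imp fun a ha => ⟨ha, by simp⟩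
  · obtain ⟨x, hx, hmax⟩ := (hv.upperSemicontinuousOn K).exists_isMaxOn hne hK
    exact ⟨v x, hlt x hx, hmax⟩

namespace IsUpperLim

variable [LocallyCompactSpace E]

theorem frequently_exists_isLocalMax (hv : IsUpperLim l f v) (hf : ∀ i, UpperSemicontinuous (f i))
    (hmax : ∀ᶠ x in 𝓝 ξ, x ≠ ξ → v x < v ξ) {P : ι × E × ℝ → Prop}
    (hP : ∀ᶠ p in l ×ˢ 𝓝 (ξ, v ξ), P p) :
    ∃ᶠ i in l, ∃ y, IsLocalMax (f i) y ∧ P (i, y, f i y) := by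
  obtain ⟨S, hS, T, hT, hST⟩ := eventually_prod_iff.1 hP
  obtain ⟨G, hG, J, hJ, hGJ⟩ := mem_nhds_prod_iff.1 hT
  obtain ⟨c, d, ⟨hcv, hvd⟩, hcd⟩ := mem_nhds_iff_exists_Ioo_subset.1 hJ
  obtain ⟨B, hBξ, hBmax, hB⟩ := local_compact_nhds hmax
  have hinner : interior (G ∩ B) ∈ 𝓝 ξ := interior_mem_nhds.2 (inter_mem hG hBξ)
  set A := B \ interior (G ∩ B)
  have hA : IsCompact A := hB.diff isOpen_interior
  obtain ⟨a, hav, hAa⟩ := exists_lt_forall_le_of_isCompact hv.upperSemicontinuous hA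
    fun x hx => hBmax hx.1 fun h => hx.2 (h ▸ mem_of_mem_nhds hinner)
  obtain ⟨b, hab, hbv⟩ := exists_between (max_lt hav hcv)
  have hsmall : ∀ᶠ i in l, ∀ x ∈ A, f i x < b := eventually_forall_mem_of_isCompact hA
    fun x hx => hv.eventually_lt ((hAa x hx).trans_lt ((le_max_left a c).trans_lt hab))
  have hbelow : ∀ᶠ i in l, ∀ x ∈ B, f i x < d := eventually_forall_mem_of_isCompact hB
    fun x hx => hv.eventually_lt <| by
      obtain rfl | hne := eq_or_ne x ξ
      exacts [hvd, (hBmax hx hne).trans hvd]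
  have hlarge : ∃ᶠ i in l, ∃ x ∈ B, b < f i x := tendsto_fst.frequently <|
    ((hv.frequently_lt hbv).and_eventually (tendsto_snd.eventually hBξ)).mono
      fun p hp => ⟨p.2, hp.2, hp.1⟩
  refine (hlarge.and_eventually (hsmall.and (hbelow.and hS))).mono ?_
  rintro i ⟨⟨x, hxB, hbx⟩, hsmall, hbelow, hSi⟩
  obtain ⟨y, hyB, hy⟩ := ((hf i).upperSemicontinuousOn B).exists_isMaxOn ⟨x, hxB⟩ hB
  have hby : b < f i y := hbx.trans_le (hy hxB)
  have hyin : y ∈ interior (G ∩ B) := by_contra fun h => (hsmall y ⟨hyB, h⟩).not_gt hby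
  refine ⟨y, hy.isLocalMax (mem_of_superset (isOpen_interior.mem_nhds hyin)
    (interior_subset.trans inter_subset_right)), hST hSi (hGJ ⟨(interior_subset hyin).1, hcd ?_⟩)⟩
  exact ⟨(le_max_right a c).trans_lt (hab.trans hby), hbelow y hyB⟩

theorem frequently_exists_isLocalMax_sub (hv : IsUpperLim l f v)
    (hf : ∀ i, UpperSemicontinuous (f i)) (hφ : Continuous φ)
    (hmax : ∀ᶠ x in 𝓝 ξ, x ≠ ξ → v x - φ x < v ξ - φ ξ) {P : ι × E × ℝ → Prop}
    (hP : ∀ᶠ p in l ×ˢ 𝓝 (ξ, v ξ), P p) :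
    ∃ᶠ i in l, ∃ y, IsLocalMax (f i - φ) y ∧ P (i, y, f i y) := by
  have hshift : Tendsto (fun q : E × ℝ => (q.1, q.2 + φ q.1)) (𝓝 (ξ, (v - φ) ξ)) (𝓝 (ξ, v ξ)) := by
    have h : Continuous fun q : E × ℝ => (q.1, q.2 + φ q.1) := by fun_prop
    simpa using h.tendsto (ξ, (v - φ) ξ)
  have husc (i : ι) : UpperSemicontinuous (f i - φ) := by
    rw [sub_eq_add_neg]
    exact (hf i).add hφ.neg.upperSemicontinuous
  simpa using (hv.sub_continuous hφ).frequently_exists_isLocalMax husc hmax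
    ((tendsto_id.prodMap hshift).eventually hP)

end IsUpperLim

end UpperLimit

section Envelope

variable {E : Type*} [TopologicalSpace E] {v : E → ℝ}

/-- The lower semicontinuous envelope of `v`. It is only used for `v ≥ 0`, where the `liminf` is
not a junk value. -/
def lowerEnv (v : E → ℝ) (x : E) : ℝ := liminf v (𝓝 x)

theorem isCoboundedUnder_ge_nhds (v : E → ℝ) (x : E) : IsCoboundedUnder (· ≥ ·) (𝓝 x) v :=
  ⟨v x, fun _ ha => (eventually_map.1 ha).self_of_nhds⟩

theorem lowerEnv_le (hv : ∀ x, 0 ≤ v x) (x : E) : lowerEnv v x ≤ v x :=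
  liminf_le_of_le (isBoundedUnder_of ⟨0, hv⟩) fun _ ha => ha.self_of_nhds

theorem le_lowerEnv {x : E} {a : ℝ} (h : ∀ᶠ y in 𝓝 x, a ≤ v y) : a ≤ lowerEnv v x :=
  le_liminf_of_le (isCoboundedUnder_ge_nhds v x) h

theorem lowerEnv_nonneg (hv : ∀ x, 0 ≤ v x) (x : E) : 0 ≤ lowerEnv v x :=
  le_lowerEnv (Eventually.of_forall hv)

theorem apply_le_lowerEnv {g : E → ℝ} {x : E} (hg : ContinuousAt g x) (h : ∀ᶠ y in 𝓝 x, g y ≤ v y) :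
    g x ≤ lowerEnv v x := by
  refine le_of_forall_lt fun a hax => ?_
  obtain ⟨b, hab, hbx⟩ := exists_between hax
  refine hab.trans_le (le_lowerEnv ?_)
  filter_upwards [h, hg.eventually_const_lt hbx] with y hgv hbg using hbg.le.trans hgv

theorem lowerSemicontinuous_lowerEnv (hv : ∀ x, 0 ≤ v x) : LowerSemicontinuous (lowerEnv v) := by
  intro x a hax
  obtain ⟨b, hab, hbx⟩ := exists_between hax
  have hb : ∀ᶠ y in 𝓝 x, b < v y := eventually_lt_of_lt_liminf hbx (isBoundedUnder_of ⟨0, hv⟩)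
  filter_upwards [hb.eventually_nhds] with y hy
  exact hab.trans_le (le_lowerEnv (hy.mono fun _ => le_of_lt))

theorem upperSemicontinuous_sup_indicator {g : E → ℝ} {W : Set E} (hv : UpperSemicontinuous v)
    (hv0 : ∀ x, 0 ≤ v x) (hg : Continuous g) (hgv : ∀ x ∈ frontier W, g x ≤ v x) :
    UpperSemicontinuous (v ⊔ W.indicator g) := by
  intro x a hxa
  obtain ⟨hva, hga⟩ := max_lt_iff.1 (show max (v x) (W.indicator g x) < a from hxa)
  by_cases hx : x ∈ closure W
  · have hga : g x < a := by
      by_cases hxW : x ∈ W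
      · rwa [indicator_of_mem hxW] at hga
      · exact (hgv x ⟨hx, fun h => hxW (interior_subset h)⟩).trans_lt hva
    filter_upwards [hv x a hva, hg.continuousAt.eventually_lt_const hga] with y hvy hgy
    refine max_lt hvy ?_
    by_cases hyW : y ∈ W
    · rwa [indicator_of_mem hyW]
    · rw [indicator_of_notMem hyW]
      exact (hv0 y).trans_lt hvy
  · filter_upwards [hv x a hva, isClosed_closure.isOpen_compl.mem_nhds hx] with y hvy hy
    refine max_lt hvy ?_
    rw [indicator_of_notMem fun h => hy (subset_closure h)]
    exact (hv0 y).trans_lt hvy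

end Envelope

/-- `u` is the extension by zero of a nonnegative upper semicontinuous viscosity subsolution of
`F[u] ≤ lam u^α + c` in `K`, `u ≤ 0` on `∂K`, the boundary condition being relaxed. After the
extension the latter amounts to the differential inequality at all points where `u` is positive,
with test functions touching from above on the whole space. -/
structure IsNonnegSubsolution {N : ℕ} (F : Op N) (α lam c : ℝ) (K : Set (Sp N)) (u : Sp N → ℝ) :
    Prop where
  upperSemicontinuous : UpperSemicontinuous u
  nonneg : ∀ x, 0 ≤ u x
  eq_zero : ∀ x ∉ K, u x = 0
  le_of_isLocalMax : ∀ φ : Sp N → ℝ, ContDiff ℝ 2 φ → ∀ ξ, 0 < u ξ → IsLocalMax (u - φ) ξ →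
    F ξ (u ξ) (gradient φ ξ) (hessian φ ξ) ≤ lam * u ξ ^ α + c

section Subsolution

variable {N : ℕ} {F : Op N} {O K : Set (Sp N)} {α lam c : ℝ} {u v : Sp N → ℝ} {ξ : Sp N}

namespace IsNonnegSubsolution

theorem zero (F : Op N) (α lam c : ℝ) (K : Set (Sp N)) :
    IsNonnegSubsolution F α lam c K fun _ => 0 where
  upperSemicontinuous := upperSemicontinuous_const
  nonneg _ := le_rfl
  eq_zero _ _ := rfl
  le_of_isLocalMax _ _ _ h := absurd h (lt_irrefl 0)

theorem mem_of_pos (hu : IsNonnegSubsolution F α lam c K u) {x : Sp N} (hx : 0 < u x) : x ∈ K :=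
  by_contra fun h => hx.ne' (hu.eq_zero x h)

theorem mono (hu : IsNonnegSubsolution F α lam c K u) {c' : ℝ} (hc : c ≤ c') :
    IsNonnegSubsolution F α lam c' K u where
  __ := hu
  le_of_isLocalMax φ hφ ξ hξ hmax :=
    (hu.le_of_isLocalMax φ hφ ξ hξ hmax).trans (add_le_add_right hc _)

theorem const_smul (hu : IsNonnegSubsolution F α lam c K u) (h2 : H2 F O α) (hKO : K ⊆ O) {m : ℝ}
    (hm : 0 < m) : IsNonnegSubsolution F α lam (m ^ α * c) K (m • u) where
  upperSemicontinuous :=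
    (continuous_const_mul m).comp_upperSemicontinuous hu.upperSemicontinuous
      (monotone_mul_left_of_nonneg hm.le)
  nonneg x := mul_nonneg hm.le (hu.nonneg x)
  eq_zero x hx := by simp [hu.eq_zero x hx]
  le_of_isLocalMax φ hφ ξ hξ hmax := by
    have hpos : 0 < u ξ := (mul_pos_iff_of_pos_left hm).1 hξ
    have hmax' : IsLocalMax (u - m⁻¹ • φ) ξ := by
      have hscale : u - m⁻¹ • φ = m⁻¹ • (m • u - φ) := by
        rw [smul_sub, inv_smul_smul₀ hm.ne']
      rw [hscale]
      exact hmax.comp_mono (monotone_mul_left_of_nonneg (inv_pos.2 hm).le)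
    have hle := hu.le_of_isLocalMax (m⁻¹ • φ) (hφ.const_smul m⁻¹) ξ hpos hmax'
    rw [gradient_const_smul, hessian_const_smul] at hle
    have hF := h2 ξ (hKO (hu.mem_of_pos hpos)) (u ξ) (m⁻¹ • gradient φ ξ) (m⁻¹ • hessian φ ξ)
      ((isSymm_hessian hφ ξ).smul _) m hm.le
    rw [smul_inv_smul₀ hm.ne', smul_inv_smul₀ hm.ne'] at hF
    calc F ξ (m * u ξ) (gradient φ ξ) (hessian φ ξ)
        = m ^ α * F ξ (u ξ) (m⁻¹ • gradient φ ξ) (m⁻¹ • hessian φ ξ) := hF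
      _ ≤ m ^ α * (lam * u ξ ^ α + c) := by gcongr
      _ = lam * (m * u ξ) ^ α + m ^ α * c := by
        rw [Real.mul_rpow hm.le hpos.le]
        ring

theorem of_isUpperLim {ι : Type*} {l : Filter ι} [NeBot l] {K : ι → Set (Sp N)} {C : Set (Sp N)}
    {lam c : ι → ℝ} {lam₀ c₀ : ℝ} {u : ι → Sp N → ℝ} (hα : 0 < α) (hO : IsOpen O)
    (hF : ContinuousOp F O) (hu : ∀ i, IsNonnegSubsolution F α (lam i) (c i) (K i) (u i))
    (hv : IsUpperLim l u v) (hlam : Tendsto lam l (𝓝 lam₀)) (hc : Tendsto c l (𝓝 c₀))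
    (hK : ∀ x ∉ C, ∀ᶠ p in l ×ˢ 𝓝 x, p.2 ∉ K p.1) (hCO : C ⊆ O) :
    IsNonnegSubsolution F α lam₀ c₀ C v := by
  have hnonneg : ∀ x, 0 ≤ v x := hv.le_of_forall_ge fun i => (hu i).nonneg
  have hzero : ∀ x ∉ C, v x = 0 := fun x hx => le_antisymm
    (hv.le_of_eventually_le ((hK x hx).mono fun p hp => ((hu p.1).eq_zero _ hp).le)) (hnonneg x)
  refine ⟨hv.upperSemicontinuous, hnonneg, hzero, fun φ hφ ξ hξ hmax => ?_⟩
  by_contra! hlt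
  have hξO : ξ ∈ O := hCO (by_contra fun h => hξ.ne' (hzero ξ h))
  set θ := φ + (1 : ℝ) • quartic ξ
  have hθ : ContDiff ℝ 2 θ := hφ.add ((contDiff_quartic ξ).const_smul (1 : ℝ))
  have hstrict : ∀ᶠ x in 𝓝 ξ, x ≠ ξ → v x - θ x < v ξ - θ ξ := by
    filter_upwards [hmax] with x hx hne
    have hle : v x - φ x ≤ v ξ - φ ξ := hx
    have hpos := quartic_pos hne
    simp only [θ, Pi.add_apply, one_smul, quartic_self]
    linarith
  have hviol : ∀ᶠ p in l ×ˢ 𝓝 (ξ, v ξ), 0 <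
      F p.2.1 p.2.2 (gradient θ p.2.1) (hessian θ p.2.1) - (lam p.1 * p.2.2 ^ α + c p.1) := by
    refine (hF.tendsto_residual hO hα hθ hξO (continuousAt_fst.tendsto.comp tendsto_snd)
      (continuousAt_snd.tendsto.comp tendsto_snd) (hlam.comp tendsto_fst)
      (hc.comp tendsto_fst)).eventually_const_lt ?_
    rwa [gradient_add_smul_quartic_self hφ, hessian_add_smul_quartic_self hφ, sub_pos]
  have hpos : ∀ᶠ p in l ×ˢ 𝓝 (ξ, v ξ), 0 < p.2.2 :=
    tendsto_snd.eventually (continuousAt_snd.tendsto.eventually_const_lt hξ)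
  obtain ⟨i, y, hy, hviol, hpos⟩ := (hv.frequently_exists_isLocalMax_sub
    (fun i => (hu i).upperSemicontinuous) hθ.continuous hstrict (hviol.and hpos)).exists
  exact (sub_pos.1 hviol).not_ge ((hu i).le_of_isLocalMax θ hθ y hpos hy)

theorem sup_indicator (hv : IsNonnegSubsolution F α lam c K v) (h1 : H1 F O) (hKO : K ⊆ O)
    {W : Set (Sp N)} (hW : IsOpen W) (hWK : W ⊆ K) {g : Sp N → ℝ} (hg : ContDiff ℝ 2 g)
    (hgv : ∀ x ∈ frontier W, g x ≤ v x)
    (hgF : ∀ x ∈ W, F x (g x) (gradient g x) (hessian g x) ≤ lam * g x ^ α + c) :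
    IsNonnegSubsolution F α lam c K (v ⊔ W.indicator g) where
  upperSemicontinuous :=
    upperSemicontinuous_sup_indicator hv.upperSemicontinuous hv.nonneg hg.continuous hgv
  nonneg x := (hv.nonneg x).trans le_sup_left
  eq_zero x hx := by simp [hv.eq_zero x hx, indicator_of_notMem fun h => hx (hWK h)]
  le_of_isLocalMax φ hφ ξ hξ hmax := by
    set w := v ⊔ W.indicator g
    by_cases hwv : w ξ = v ξ
    · rw [hwv] at hξ ⊢
      refine hv.le_of_isLocalMax φ hφ ξ hξ (hmax.mono fun x hx => ?_)
      calc v x - φ x ≤ w x - φ x := sub_le_sub_right le_sup_left _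
        _ ≤ w ξ - φ ξ := hx
        _ = v ξ - φ ξ := by rw [hwv]
    · have hwi : w ξ = W.indicator g ξ := (max_choice _ _).resolve_left hwv
      have hξW : ξ ∈ W := by
        by_contra h
        exact hξ.ne' (by rw [hwi, indicator_of_notMem h])
      have hwg : w ξ = g ξ := by rw [hwi, indicator_of_mem hξW]
      have hmin : IsLocalMin (φ - g) ξ := by
        filter_upwards [hmax, hW.mem_nhds hξW] with x hx hxW
        have hle : w x - φ x ≤ w ξ - φ ξ := hx
        have hgw : g x ≤ w x := by
          rw [← indicator_of_mem hxW g]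
          exact le_sup_right
        simp only [Pi.sub_apply]
        linarith
      rw [hwg]
      exact (h1.le_of_isLocalMin hφ hg (hKO (hWK hξW)) hmin _).trans (hgF ξ hξW)

theorem exists_bump (hv : IsNonnegSubsolution F α lam c K v) (hα : 0 < α) (hO : IsOpen O)
    (hF : ContinuousOp F O) (h1 : H1 F O) (hKO : K ⊆ O) (hξ : ξ ∈ interior K) {χ : Sp N → ℝ}
    (hχ : ContDiff ℝ 2 χ) (hχv : ∀ᶠ x in 𝓝 ξ, χ x + quartic ξ x ≤ v x)
    (hstrict : F ξ (χ ξ) (gradient χ ξ) (hessian χ ξ) < lam * χ ξ ^ α + c) :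
    ∃ w, IsNonnegSubsolution F α lam c K w ∧ ∃ δ > 0, ∀ᶠ x in 𝓝 ξ, χ x + δ ≤ w x := by
  have hshift : ContinuousAt (fun q : Sp N × ℝ => χ q.1 + q.2) (ξ, 0) :=
    ((hχ.continuous.comp continuous_fst).add continuous_snd).continuousAt
  have hsub : ∀ᶠ q in 𝓝 ((ξ, 0) : Sp N × ℝ), F q.1 (χ q.1 + q.2) (gradient χ q.1) (hessian χ q.1) -
      (lam * (χ q.1 + q.2) ^ α + c) < 0 := by
    refine (hF.tendsto_residual hO hα hχ (hKO (interior_subset hξ)) continuousAt_fst.tendsto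
      hshift.tendsto tendsto_const_nhds tendsto_const_nhds).eventually_lt_const ?_
    simpa using hstrict
  have hξK : ∀ᶠ x in 𝓝 ξ, x ∈ K := mem_interior_iff_mem_nhds.1 hξ
  have hbase : ∀ᶠ q in 𝓝 ((ξ, 0) : Sp N × ℝ), q.1 ∈ K ∧ χ q.1 + quartic ξ q.1 ≤ v q.1 :=
    (continuous_fst.tendsto (ξ, (0 : ℝ))).eventually (hξK.and hχv)
  obtain ⟨ρ, hρ, hball⟩ := Metric.eventually_nhds_iff.1 (hsub.and hbase)
  obtain ⟨r, hr, hrρ⟩ := exists_between hρ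
  obtain ⟨δ, hδ, hδlt⟩ := exists_between (lt_min hρ (by positivity : 0 < (r ^ 2) ^ 2))
  obtain ⟨hδρ, hδr⟩ := lt_min_iff.1 hδlt
  have hnear {x : Sp N} (hx : dist x ξ ≤ r) := hball (y := (x, δ)) <| by
    simpa [Prod.dist_eq, abs_of_pos hδ] using ⟨hx.trans_lt hrρ, hδρ⟩
  have hgv : ∀ x ∈ frontier (Metric.ball ξ r), χ x + δ ≤ v x := fun x hx => by
    have hxr : dist x ξ = r := Metric.frontier_ball_subset_sphere hx
    have hq : quartic ξ x = (r ^ 2) ^ 2 := by rw [quartic, ← dist_eq_norm, hxr]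
    linarith [(hnear hxr.le).2.2]
  refine ⟨_, hv.sup_indicator h1 hKO (Metric.isOpen_ball (x := ξ) (ε := r))
    (fun x hx => (hnear (Metric.mem_ball.1 hx).le).2.1) (hχ.add contDiff_const) hgv
    fun x hx => ?_, δ, hδ, ?_⟩
  · rw [gradient_add_const, hessian_add_const]
    exact (sub_neg.1 (hnear (Metric.mem_ball.1 hx).le).1).le
  · filter_upwards [Metric.ball_mem_nhds ξ hr] with x hx
    rw [Pi.sup_apply, indicator_of_mem hx]
    exact le_sup_right

theorem le_of_isLocalMin_lowerEnv (hv : IsNonnegSubsolution F α lam c K v) (hα : 0 < α)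
    (hO : IsOpen O) (hF : ContinuousOp F O) (h1 : H1 F O) (hKO : K ⊆ O)
    (hvmax : ∀ w, IsNonnegSubsolution F α lam c K w → w ≤ v) (hξ : ξ ∈ interior K) {ψ : Sp N → ℝ}
    (hψ : ContDiff ℝ 2 ψ) (hmin : IsLocalMin (lowerEnv v - ψ) ξ) :
    lam * lowerEnv v ξ ^ α + c ≤ F ξ (lowerEnv v ξ) (gradient ψ ξ) (hessian ψ ξ) := by
  by_contra! hlt
  set χ : Sp N → ℝ := fun x => (ψ + (-1 : ℝ) • quartic ξ) x + (lowerEnv v ξ - ψ ξ)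
  have hχ : ContDiff ℝ 2 χ :=
    (hψ.add ((contDiff_quartic ξ).const_smul (-1 : ℝ))).add contDiff_const
  have hχξ : χ ξ = lowerEnv v ξ := by simp [χ, quartic_self]
  have hχv : ∀ᶠ x in 𝓝 ξ, χ x + quartic ξ x ≤ v x := by
    filter_upwards [hmin] with x hx
    have hle : lowerEnv v ξ - ψ ξ ≤ lowerEnv v x - ψ x := hx
    have hlow := lowerEnv_le hv.nonneg x
    simp only [χ, Pi.add_apply, Pi.neg_apply, neg_smul, one_smul]
    linarith
  obtain ⟨w, hw, δ, hδ, hχw⟩ := hv.exists_bump hα hO hF h1 hKO hξ hχ hχv <| by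
    rwa [gradient_add_const, hessian_add_const, gradient_add_smul_quartic_self hψ,
      hessian_add_smul_quartic_self hψ, hχξ]
  have hle : χ ξ + δ ≤ lowerEnv v ξ :=
    apply_le_lowerEnv (hχ.continuous.add_const δ).continuousAt
      (hχw.mono fun x hx => hx.trans (hvmax w hw x))
  linarith

end IsNonnegSubsolution

end Subsolution

section Eigenvalue

variable {N : ℕ} {F : Op N} {O Ω K : Set (Sp N)} {α lam : ℝ}

theorem exists_isGreatest_isNonnegSubsolution {c M : ℝ} (hα : 0 < α) (hO : IsOpen O)
    (hF : ContinuousOp F O) (hK : IsClosed K) (hKO : K ⊆ O)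
    (hbdd : ∀ u, IsNonnegSubsolution F α lam c K u → ∀ x, u x ≤ M) :
    ∃ v, IsGreatest {u | IsNonnegSubsolution F α lam c K u} v := by
  have : Nonempty {u // IsNonnegSubsolution F α lam c K u} := ⟨_, .zero F α lam c K⟩
  have hv := isUpperLim_limsup (l := ⊤)
    (f := fun u : {u // IsNonnegSubsolution F α lam c K u} => u.1)
    fun u x => ⟨u.2.nonneg x, hbdd u.1 u.2 x⟩
  refine ⟨_, .of_isUpperLim hα hO hF (fun u => u.2) hv tendsto_const_nhds tendsto_const_nhds
    (fun x hx => tendsto_snd.eventually (hK.isOpen_compl.mem_nhds hx)) hKO, ?_⟩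
  exact fun u hu => hv.apply_le_of_top ⟨u, hu⟩

theorem exists_pos_isSupersolution_of_bounded {M : ℝ} (hα : 0 < α) (hO : IsOpen O)
    (hF : ContinuousOp F O) (h1 : H1 F O) (h2 : H2 F O α) (hK : IsClosed K) (hKO : K ⊆ O)
    (hbdd : ∀ u, IsNonnegSubsolution F α lam 1 K u → ∀ x, u x ≤ M) :
    ∃ φ : Sp N → ℝ, LowerSemicontinuous φ ∧ (∀ x ∈ interior K, 0 < φ x) ∧
      IsSupersolution F α lam (interior K) φ := by
  obtain ⟨v, hv, hvmax⟩ := exists_isGreatest_isNonnegSubsolution hα hO hF hK hKO hbdd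
  have hstrict {ψ : Sp N → ℝ} (hψ : ContDiff ℝ 2 ψ) {ξ : Sp N} (hξ : ξ ∈ interior K)
      (hmin : IsLocalMin (lowerEnv v - ψ) ξ) :
      lam * lowerEnv v ξ ^ α + 1 ≤ F ξ (lowerEnv v ξ) (gradient ψ ξ) (hessian ψ ξ) :=
    hv.le_of_isLocalMin_lowerEnv hα hO hF h1 hKO hvmax hξ hψ hmin
  refine ⟨lowerEnv v, lowerSemicontinuous_lowerEnv hv.nonneg, fun ξ hξ => ?_,
    fun ψ hψ ξ hξ hmin => ?_⟩
  · refine (lowerEnv_nonneg hv.nonneg ξ).lt_of_ne' fun hzero => ?_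
    have hmin : IsLocalMin (lowerEnv v - fun _ => 0) ξ := Eventually.of_forall fun x => by
      simpa [hzero] using lowerEnv_nonneg hv.nonneg x
    have hle := hstrict contDiff_const hξ hmin
    rw [hzero, gradient_fun_const, hessian_const, h2.apply_zero hα (hKO (interior_subset hξ)),
      Real.zero_rpow hα.ne'] at hle
    norm_num at hle
  · have hle := hstrict hψ hξ (hmin.isLocalMin (isOpen_interior.mem_nhds hξ))
    linarith

theorem le_mu1 {V : Set (Sp N)} (hV : IsOpen V) (hΩV : closure Ω ⊆ V) (hVO : V ⊆ O)
    {φ : Sp N → ℝ} (hφ : LowerSemicontinuous φ) (hpos : ∀ x ∈ V, 0 < φ x)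
    (hsup : IsSupersolution F α lam V φ) : (lam : EReal) ≤ mu1 F α O Ω :=
  le_sSup ⟨lam, ⟨V, hV, hΩV, hVO, φ, hφ.lowerSemicontinuousOn V, hpos, hsup⟩, rfl⟩

theorem bot_lt_mu1 (hO : IsOpen O) (hF : ContinuousOp F O) (h1 : H1 F O)
    (hΩ : IsCompact (closure Ω)) (hΩO : closure Ω ⊆ O) : ⊥ < mu1 F α O Ω := by
  obtain ⟨K, hK, hΩK, hKO⟩ := exists_compact_between hΩ hO hΩO
  have hcont : ContinuousOn (fun x : Sp N => F x 1 0 0) K := by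
    have h : Continuous fun x : Sp N => (x, (1 : ℝ), (0 : Sp N), (0 : Mat N)) := by fun_prop
    exact hF.comp h.continuousOn fun x hx => ⟨hKO hx, Matrix.isSymm_zero⟩
  obtain ⟨b, hb⟩ := hK.bddBelow_image hcont
  refine (EReal.bot_lt_coe b).trans_le (le_mu1 isOpen_interior hΩK (interior_subset.trans hKO)
    (φ := fun _ => 1) lowerSemicontinuous_const (fun _ _ => one_pos) fun ψ hψ ξ hξ hmin => ?_)
  have hle := h1.le_of_isLocalMin contDiff_const hψ (hKO (interior_subset hξ))
    (hmin.isLocalMin (isOpen_interior.mem_nhds hξ)) 1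
  rw [gradient_fun_const, hessian_const] at hle
  rw [Real.one_rpow, mul_one, sub_nonneg]
  exact (hb ⟨ξ, interior_subset hξ, rfl⟩).trans hle

theorem exists_lt_of_mu1_lt (hα : 0 < α) (hO : IsOpen O) (hF : ContinuousOp F O) (h1 : H1 F O)
    (h2 : H2 F O α) (hK : IsClosed K) (hΩK : closure Ω ⊆ interior K) (hKO : K ⊆ O)
    (hlam : mu1 F α O Ω < lam) (M : ℝ) :
    ∃ u, IsNonnegSubsolution F α lam 1 K u ∧ ∃ x, M < u x := by
  by_contra! hbdd
  obtain ⟨φ, hφ, hpos, hsup⟩ := exists_pos_isSupersolution_of_bounded hα hO hF h1 h2 hK hKO hbdd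
  exact hlam.not_ge (le_mu1 isOpen_interior hΩK (interior_subset.trans hKO) hφ hpos hsup)

theorem exists_normalized_isNonnegSubsolution (hα : 0 < α) (hO : IsOpen O) (hF : ContinuousOp F O)
    (h1 : H1 F O) (h2 : H2 F O α) (hK : IsCompact K) (hΩK : closure Ω ⊆ interior K) (hKO : K ⊆ O)
    (hlam : mu1 F α O Ω < lam) {ε : ℝ} (hε : 0 < ε) :
    ∃ w, IsNonnegSubsolution F α lam ε K w ∧ (∀ x, w x ≤ 1) ∧ ∃ x ∈ K, w x = 1 := by
  have hsmall : ∀ᶠ M : ℝ in atTop, M⁻¹ ^ α < ε := by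
    have h : Tendsto (fun M : ℝ => M⁻¹ ^ α) atTop (𝓝 0) := by
      simpa [Real.zero_rpow hα.ne'] using tendsto_inv_atTop_zero.rpow_const (Or.inr hα.le)
    exact h.eventually_lt_const hε
  obtain ⟨M, hM⟩ := eventually_atTop.1 hsmall
  obtain ⟨u, hu, x, hx⟩ := exists_lt_of_mu1_lt hα hO hF h1 h2 hK.isClosed hΩK hKO hlam (max M 0)
  have hxK : x ∈ K := hu.mem_of_pos ((le_max_right M 0).trans_lt hx)
  obtain ⟨z, hzK, hz⟩ := (hu.upperSemicontinuous.upperSemicontinuousOn K).exists_isMaxOn ⟨x, hxK⟩ hK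
  obtain ⟨hMz, hz0⟩ := max_lt_iff.1 (hx.trans_le (hz hxK))
  refine ⟨(u z)⁻¹ • u, (hu.const_smul h2 hKO (inv_pos.2 hz0)).mono ?_, fun y => ?_,
    z, hzK, inv_mul_cancel₀ hz0.ne'⟩
  · simpa using (hM _ hMz.le).le
  · by_cases hy : y ∈ K
    · exact (inv_mul_le_one₀ hz0).2 (hz hy)
    · simp [hu.eq_zero y hy]

theorem eventually_notMem_cthickening {ι E : Type*} [PseudoEMetricSpace E] {l : Filter ι}
    {C : Set E} {r : ι → ℝ} (hr : Tendsto r l (𝓝 0)) {x : E} (hx : x ∉ closure C) :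
    ∀ᶠ p in l ×ˢ 𝓝 x, p.2 ∉ Metric.cthickening (r p.1) C := by
  rw [Metric.closure_eq_iInter_cthickening, mem_iInter₂] at hx
  push Not at hx
  obtain ⟨ε, hε, hx⟩ := hx
  have hrε : ∀ᶠ p in l ×ˢ 𝓝 x, r p.1 < ε :=
    tendsto_fst.eventually (hr.eventually_lt_const hε)
  have hxε : ∀ᶠ p in l ×ˢ 𝓝 x, p.2 ∉ Metric.cthickening ε C :=
    tendsto_snd.eventually (Metric.isClosed_cthickening.isOpen_compl.mem_nhds hx)
  filter_upwards [hrε, hxε] with p hrp hp h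
  exact hp (Metric.cthickening_mono hrp.le C h)

theorem exists_isNonnegSubsolution_of_mu1_eq {m : ℝ} (hα : 0 < α) (hO : IsOpen O)
    (hF : ContinuousOp F O) (h1 : H1 F O) (h2 : H2 F O α) (hΩ : IsCompact (closure Ω))
    (hΩO : closure Ω ⊆ O) (hm : mu1 F α O Ω = m) :
    ∃ U, IsNonnegSubsolution F α m 0 (closure Ω) U ∧ ∃ x, 0 < U x := by
  obtain ⟨δ, hδ, hδO⟩ := hΩ.exists_cthickening_subset_open hO hΩO
  obtain ⟨r, -, hr, hr0⟩ := exists_seq_strictAnti_tendsto' hδ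
  have hmono (n : ℕ) := Metric.cthickening_mono (hr n).2.le (closure Ω)
  have hinner (n : ℕ) : closure Ω ⊆ interior (Metric.cthickening (r n) (closure Ω)) :=
    (Metric.self_subset_thickening (hr n).1 _).trans
      (interior_maximal (Metric.thickening_subset_cthickening _ _) Metric.isOpen_thickening)
  have hlam (n : ℕ) : mu1 F α O Ω < (m + r n : ℝ) := by
    rw [hm, EReal.coe_lt_coe_iff]
    exact lt_add_of_pos_right m (hr n).1
  choose w hw hw1 z hz hwz using fun n => exists_normalized_isNonnegSubsolution hα hO hF h1 h2
    hΩ.cthickening (hinner n)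
    ((hmono n).trans hδO) (hlam n) (hr n).1
  have hU := isUpperLim_limsup (l := atTop) fun n x => ⟨(hw n).nonneg x, hw1 n x⟩
  refine ⟨_, .of_isUpperLim hα hO hF hw hU (by simpa using hr0.const_add m) hr0
    (fun x hx => eventually_notMem_cthickening hr0 (by rwa [closure_closure])) hΩO, ?_⟩
  obtain ⟨x, -, hx⟩ := hU.exists_le_of_isCompact (hΩ.cthickening (r := δ)) (a := 1)
    (Frequently.of_forall fun n => ⟨z n, hmono n (hz n), (hwz n).ge⟩)
  exact ⟨x, one_pos.trans_le hx⟩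

end Eigenvalue

section Dirichlet

variable {N : ℕ} {F : Op N} {O Ω : Set (Sp N)} {α : ℝ} {U φ : Sp N → ℝ} {ξ : Sp N}

theorem IsNonnegSubsolution.isLocalMax_of_isMaxOn {lam c : ℝ} {K : Set (Sp N)}
    (hU : IsNonnegSubsolution F α lam c K U) (hφ : Continuous φ) (hξ : 0 < U ξ)
    (hmax : IsMaxOn (U - φ) K ξ) : IsLocalMax (U - φ) ξ := by
  have hφξ : φ ξ - U ξ < φ ξ := sub_lt_self _ hξ
  filter_upwards [hφ.continuousAt.eventually_const_lt hφξ] with x hx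
  by_cases hxK : x ∈ K
  · exact hmax hxK
  · simp only [Pi.sub_apply, hU.eq_zero x hxK]
    linarith

theorem eigenOp_nonpos_of_isLocalMin {m : ℝ} (hα : 0 < α) (h1 : H1 F O) (h2 : H2 F O α)
    (hξ : ξ ∈ O) (hφ : ContDiff ℝ 2 φ) (hmin : IsLocalMin φ ξ) :
    eigenOp F α m ξ 0 (gradient φ ξ) (hessian φ ξ) ≤ 0 := by
  have hle := h1.le_of_isLocalMin hφ (contDiff_const (c := (0 : ℝ))) hξ
    (by simpa [Pi.sub_def] using hmin) 0
  rw [gradient_fun_const, hessian_const, h2.apply_zero hα hξ] at hle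
  simpa [eigenOp, Real.zero_rpow hα.ne'] using hle

theorem IsNonnegSubsolution.isDirichletSubsolution {m : ℝ}
    (hU : IsNonnegSubsolution F α m 0 (closure Ω) U) (hα : 0 < α) (h1 : H1 F O) (h2 : H2 F O α)
    (hΩ : IsOpen Ω) (hΩO : closure Ω ⊆ O) : IsDirichletSubsolution (eigenOp F α m) Ω U := by
  intro φ hφ ξ hξ hmax
  have hpos (h : 0 < U ξ) : eigenOp F α m ξ (U ξ) (gradient φ ξ) (hessian φ ξ) ≤ 0 := by
    have hle := hU.le_of_isLocalMax φ hφ ξ h (hU.isLocalMax_of_isMaxOn hφ.continuous h hmax)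
    rw [eigenOp]
    norm_cast
    linarith
  obtain hUξ | hUξ := (hU.nonneg ξ).lt_or_eq'
  · exact ⟨fun _ => hpos hUξ, fun _ => (min_le_right _ _).trans (hpos hUξ)⟩
  · refine ⟨fun hξΩ => ?_, fun _ => (min_le_left _ _).trans (by simp [hUξ])⟩
    have hmin : IsLocalMin φ ξ := by
      filter_upwards [hΩ.mem_nhds hξΩ] with x hx
      have hle : U x - φ x ≤ U ξ - φ ξ := hmax (subset_closure hx)
      linarith [hU.nonneg x]
    rw [hUξ]
    exact eigenOp_nonpos_of_isLocalMin hα h1 h2 (hΩO hξ) hφ hmin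

theorem isDirichletSubsolution_eigenOp_top_one (F : Op N) (α : ℝ) (Ω : Set (Sp N)) :
    IsDirichletSubsolution (eigenOp F α ⊤) Ω fun _ => 1 := by
  intro φ _ ξ _ _
  have h : eigenOp F α ⊤ ξ 1 (gradient φ ξ) (hessian φ ξ) ≤ 0 := by
    simp [eigenOp, EReal.sub_top]
  exact ⟨fun _ => h, fun _ => (min_le_right _ _).trans h⟩

theorem exists_isDirichletSubsolution_mu1 (hα : 0 < α) (hO : IsOpen O) (hF : ContinuousOp F O)
    (h1 : H1 F O) (h2 : H2 F O α) (hΩ : IsOpen Ω) (hne : Ω.Nonempty)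
    (hΩc : IsCompact (closure Ω)) (hΩO : closure Ω ⊆ O) :
    ∃ U : Sp N → ℝ, UpperSemicontinuousOn U (closure Ω) ∧ (∀ x ∈ closure Ω, 0 ≤ U x) ∧
      (∃ x ∈ closure Ω, U x ≠ 0) ∧ IsDirichletSubsolution (eigenOp F α (mu1 F α O Ω)) Ω U := by
  have hbot : ⊥ < mu1 F α O Ω := bot_lt_mu1 hO hF h1 hΩc hΩO
  induction hμ : mu1 F α O Ω with
  | bot => exact absurd hμ hbot.ne'
  | coe m =>
    obtain ⟨U, hU, x, hx⟩ := exists_isNonnegSubsolution_of_mu1_eq hα hO hF h1 h2 hΩc hΩO hμ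
    exact ⟨U, hU.upperSemicontinuous.upperSemicontinuousOn _, fun x _ => hU.nonneg x,
      ⟨x, hU.mem_of_pos hx, hx.ne'⟩, hU.isDirichletSubsolution hα h1 h2 hΩ hΩO⟩
  | top =>
    obtain ⟨x, hx⟩ := hne
    exact ⟨fun _ => 1, upperSemicontinuous_const.upperSemicontinuousOn _,
      fun _ _ => zero_le_one, ⟨x, subset_closure hx, one_ne_zero⟩,
      isDirichletSubsolution_eigenOp_top_one F α Ω⟩

theorem coe_le_eigenOp {m : EReal} (hm : m ≤ 0) {r : ℝ} (hr : 0 ≤ r) (x p : Sp N) (X : Mat N) :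
    (F x r p X : EReal) ≤ eigenOp F α m x r p X := by
  have hmul : m * ((r ^ α : ℝ) : EReal) ≤ 0 :=
    mul_nonpos_of_nonpos_of_nonneg hm (EReal.coe_nonneg.2 (Real.rpow_nonneg hr α))
  simpa [eigenOp] using EReal.sub_le_sub (le_refl (F x r p X : EReal)) hmul

theorem IsDirichletSubsolution.of_le {G H : Sp N → ℝ → Sp N → Mat N → EReal}
    (hU : IsDirichletSubsolution H Ω U)
    (hGH : ∀ x ∈ closure Ω, ∀ p X, G x (U x) p X ≤ H x (U x) p X) :
    IsDirichletSubsolution G Ω U := fun φ hφ ξ hξ hmax =>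
  ⟨fun h => (hGH ξ hξ _ _).trans ((hU φ hφ ξ hξ hmax).1 h),
    fun h => (min_le_min_left _ (hGH ξ hξ _ _)).trans ((hU φ hφ ξ hξ hmax).2 h)⟩

end Dirichlet

end DegEll

end

theorem proposition3p2_general (N : ℕ) (O Ω : Set (DegEll.Sp N)) (hO : IsOpen O)
    (hΩ : IsOpen Ω) (hne : Ω.Nonempty) (hΩb : Bornology.IsBounded Ω) (hΩO : closure Ω ⊆ O)
    (F : DegEll.Op N) (α : ℝ) (hα : 0 < α) (hF : DegEll.ContinuousOp F O)
    (h1 : DegEll.H1 F O) (h2 : DegEll.H2 F O α) :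
    (∃ U : DegEll.Sp N → ℝ, UpperSemicontinuousOn U (closure Ω) ∧
      (∀ x ∈ closure Ω, 0 ≤ U x) ∧ (∃ x ∈ closure Ω, U x ≠ 0) ∧
      DegEll.IsDirichletSubsolution (DegEll.eigenOp F α (DegEll.mu1 F α O Ω)) Ω U) ∧
    (DegEll.MaximumPrinciple F Ω → 0 < DegEll.mu1 F α O Ω) := by
  obtain ⟨U, hU, hU0, ⟨x, hx, hxne⟩, hUsub⟩ := DegEll.exists_isDirichletSubsolution_mu1
    hα hO hF h1 h2 hΩ hne hΩb.isCompact_closure hΩO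
  refine ⟨⟨U, hU, hU0, ⟨x, hx, hxne⟩, hUsub⟩, fun hMP => ?_⟩
  by_contra! hμ
  have hUF : DegEll.IsDirichletSubsolution (fun x r p X => (F x r p X : EReal)) Ω U :=
    hUsub.of_le fun y hy p X => DegEll.coe_le_eigenOp hμ (hU0 y hy) y p X
  exact hxne (le_antisymm (hMP U hU hUF x hx) (hU0 x hx))

theorem proposition3p2 (N : ℕ) (O Ω : Set (DegEll.Sp N)) (hO : IsOpen O)
    (hΩ : IsOpen Ω) (hΩc : IsConnected Ω) (hΩb : Bornology.IsBounded Ω) (hΩO : closure Ω ⊆ O)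
    (F : DegEll.Op N) (α : ℝ) (hα : 0 < α) (hF : DegEll.ContinuousOp F O)
    (h1 : DegEll.H1 F O) (h2 : DegEll.H2 F O α) (h3 : DegEll.H3 F O) (h4 : DegEll.H4 F O) :
    (∃ U : DegEll.Sp N → ℝ, UpperSemicontinuousOn U (closure Ω) ∧
      (∀ x ∈ closure Ω, 0 ≤ U x) ∧ (∃ x ∈ closure Ω, U x ≠ 0) ∧
      DegEll.IsDirichletSubsolution (DegEll.eigenOp F α (DegEll.mu1 F α O Ω)) Ω U) ∧
    (DegEll.MaximumPrinciple F Ω → 0 < DegEll.mu1 F α O Ω) :=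
  proposition3p2_general N O Ω hO hΩ hΩc.nonempty hΩb hΩO F α hα hF h1 h2
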